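/- Let $G=(\{1,\dots,r\},E)$ be a finite directed graph (loops allowed) that is irreducible (strongly connected) and aperiodic, with $d:=|E|-r\ge 1$. Choose a set $E_d\subseteq E$ obtained by leaving out exactly one outgoing edge of each state, so $|E_d|=d$. A vector $\theta\in\mathbb R^{E_d}$ determines numbers $p_\theta(i,j)$: $p_\theta(i,j)=\theta_{ij}$ for $(i,j)\in E_d$, $p_\theta(i,j)=1-\sum_{(i,j')\in E_d}\theta_{ij'}$ for $(i,j)\in E\setminus E_d$, and $p_\theta(i,j)=0$ for $(i,j)\notin E$. Let $R\subset\mathbb R^{E_d}$ be the set of $\theta$ with $p_\theta(i,j)>0$ for all $(i,j)\in E$. There are infinitely many users $u=1,2,3,\dots$. User $u$ has a random vector $\mathbf P_u\in\mathbb R^{E_d}$ of free transition probabilities. The vectors $\mathbf P_1,\mathbf P_2,\dots$ are independent; $\mathbf P_2,\mathbf P_3,\dots$ have a density $f$ on $\mathbb R^{E_d}$ with $\delta_1<f<\delta_2$ on $R$ and $f=0$ off $R$, for some constants $\delta_1,\delta_2>0$; and $\mathbf P_1$ is any random vector with $\mathbf P_1\in R$ almost surely (for instance it also has density $f$, or it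 is a fixed point of $R$). The adversary knows the realization of $(\mathbf P_u)_u$. Given this realization, the users move independently; the locations $X_u(1),X_u(2),\dots$ of user $u$ form a Markov chain with transition probabilities $p_{\mathbf P_u}(i,j)$ started at a common fixed state $s$. For each $n$, a permutation $\Pi^{(n)}$ of $\{1,\dots,n\}$, uniformly distributed and independent of all movements, assigns pseudonym $\Pi^{(n)}(u)$ to user $u$, and the adversary observes $$\mathbf Y^{(m)}=\Bigl(\bigl(X_{(\Pi^{(n)})^{-1}(v)}(1),\dots,X_{(\Pi^{(n)})^{-1}(v)}(m)\bigr)\Bigr)_{v=1}^n .$$ Let $c,\alpha>0$ be constants and let $m=m(n)$ be $c\,n^{\frac{2}{|E|-r}-\alpha}$ rounded up or down to an integer. Then for almost every realization of $(\mathbf P_u)_u$, user 1 has perfect location privacy: for every $k\in\mathbb N$, $k\ge1$, $$\lim_{n\to\infty} I\bigl(X_1(k);\mathbf Y^{(m)}\bigr)=0,$$ where $I$ is the mutual information computed, with that realization fixed, over the movements and $\Pi^{(n)}$. -/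

import Mathlib

open MeasureTheory ProbabilityTheory Filter Topology
open scoped ENNReal

namespace LocationPrivacy

/-! ### The common graph and its Markov chains -/

/-- The 0/1 adjacency matrix of the directed graph on `Fin r` with edge set `E`
(loops are allowed). -/
def adjacency {r : ℕ} (E : Finset (Fin r × Fin r)) : Matrix (Fin r) (Fin r) ℝ :=
  Matrix.of fun i j => if (i, j) ∈ E then 1 else 0

/-- A nonnegative square matrix is aperiodic if every state has period one: for each `i`, the
greatest common divisor of the lengths `n ≥ 1` of closed walks `i → i` (i.e. `0 < (A ^ n) i i`)
equals `1`. -/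
def IsAperiodic {r : ℕ} (A : Matrix (Fin r) (Fin r) ℝ) : Prop :=
  ∀ i : Fin r, ∀ g : ℕ, (∀ n : ℕ, 0 < n → 0 < (A ^ n) i i → g ∣ n) → g = 1

/-- `Ed` is a choice of free edges of the graph `E`: out of every state exactly one edge of `E`
is left out. The probabilities of the edges in `Ed` are then free parameters, and the row-sum
conditions determine the remaining ones; in particular `Ed` has `|E| - r` elements. -/
def IsFreeEdgeSet {r : ℕ} (E Ed : Finset (Fin r × Fin r)) : Prop :=
  Ed ⊆ E ∧ ∀ i : Fin r, ∃! j : Fin r, (i, j) ∈ E ∧ (i, j) ∉ Ed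

/-- The transition matrix determined by the values `θ` of the free transition probabilities:
on a remaining edge `(i, j)` the probability is whatever is left in row `i`. -/
noncomputable def transitionMatrix {r : ℕ} (E Ed : Finset (Fin r × Fin r)) (θ : Ed → ℝ) :
    Matrix (Fin r) (Fin r) ℝ :=
  Matrix.of fun i j =>
    if h : (i, j) ∈ Ed then θ ⟨(i, j), h⟩
    else if (i, j) ∈ E then 1 - ∑ e : Ed, (if e.1.1 = i then θ e else 0)
    else 0

/-- The set of acceptable parameter vectors: every edge of `E` gets positive probability (so that
`E` is exactly the set of edges of the chain). -/
def paramRegion {r : ℕ} (E Ed : Finset (Fin r × Fin r)) : Set (Ed → ℝ) :=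
  {θ | ∀ i j : Fin r, (i, j) ∈ E → 0 < transitionMatrix E Ed θ i j}

/-! ### Movements, anonymization and mutual information

Users are indexed by `ℕ`, user `0` being "user 1"; `X u t` is the location of user `u` at the
`(t + 1)`-st time, so the first `m` observation times are `t = 0, …, m - 1`. -/

/-- Under `Q`, the process `X` is a Markov chain with initial state `s` and transition
matrix `A`. -/
def IsMarkovChain {Ω : Type*} [MeasurableSpace Ω] {r : ℕ} (Q : Measure Ω) (s : Fin r)
    (A : Matrix (Fin r) (Fin r) ℝ) (X : ℕ → Ω → Fin r) : Prop :=
  ∀ (L : ℕ) (x : ℕ → Fin r),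
    Q {ω | ∀ t ≤ L, X t ω = x t} =
      ENNReal.ofReal (if x 0 = s then ∏ t ∈ Finset.range L, A (x t) (x (t + 1)) else 0)

instance permMeasurableSpace (n : ℕ) : MeasurableSpace (Equiv.Perm (Fin n)) := ⊤

/-- Under `Q`, the users move independently, user `u` as a Markov chain with transition matrix
`A u` started at `s`, and for every `n` the permutation `Pm n` of the `n` users (`Pm n ω u` is the
pseudonym of user `u`) is uniformly distributed and independent of all movements. -/
structure IsAnonymizedModel {Ω : Type*} [MeasurableSpace Ω] {r : ℕ} (Q : Measure Ω) (s : Fin r)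
    (A : ℕ → Matrix (Fin r) (Fin r) ℝ) (X : ℕ → ℕ → Ω → Fin r)
    (Pm : (n : ℕ) → Ω → Equiv.Perm (Fin n)) : Prop where
  measurable_loc : ∀ u t, Measurable (X u t)
  measurable_perm : ∀ n, Measurable (Pm n)
  chain : ∀ u, IsMarkovChain Q s (A u) (X u)
  indep_users : iIndepFun (fun (u : ℕ) (ω : Ω) (t : ℕ) => X u t ω) Q
  uniform_perm : ∀ (n : ℕ) (π : Equiv.Perm (Fin n)), Q {ω | Pm n ω = π} = (n.factorial : ℝ≥0∞)⁻¹
  indep_perm : ∀ n, IndepFun (Pm n) (fun (ω : Ω) (u t : ℕ) => X u t ω) Q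

/-- The adversary's data: the user with pseudonym `v` among `n` users is observed `m` times. -/
def observation {Ω : Type*} {r : ℕ} (X : ℕ → ℕ → Ω → Fin r) {n : ℕ}
    (Pm : Ω → Equiv.Perm (Fin n)) (m : ℕ) : Ω → (Fin n → Fin m → Fin r) :=
  fun ω v t => X ((Pm ω).symm v : ℕ) t ω

/-- Mutual information `I(U; V)`: the Kullback–Leibler divergence of the joint law from the
product of the marginal laws. -/
noncomputable def mutualInfo {Ω S T : Type*} [MeasurableSpace Ω] [MeasurableSpace S]
    [MeasurableSpace T] (Q : Measure Ω) (U : Ω → S) (V : Ω → T) : ℝ≥0∞ :=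
  InformationTheory.klDiv (Q.map fun ω => (U ω, V ω)) ((Q.map U).prod (Q.map V))

/-- User `u` has perfect location privacy at time index `t` when the adversary gets `m n`
observations of each of `n` users. -/
def PerfectLocationPrivacy {Ω : Type*} [MeasurableSpace Ω] {r : ℕ} (Q : Measure Ω)
    (X : ℕ → ℕ → Ω → Fin r) (Pm : (n : ℕ) → Ω → Equiv.Perm (Fin n)) (m : ℕ → ℕ)
    (u t : ℕ) : Prop :=
  Tendsto (fun n => mutualInfo Q (X u t) (observation X (Pm n) (m n))) atTop (𝓝 0)

end LocationPrivacy

open LocationPrivacy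

open LocationPrivacy

/-! User 1 hides among users whose parameters lie within `n ^ (-β)` of its own, with `β` slightly
below `1 / d`.

Such users are numerous: a ball of radius `n ^ (-β)` has probability of order at least `n ^ (-β *
d)`, so the expected number is at least of order `n ^ (1 - β * d)`. Exponential bounds, summable in
`n`, make the number tend to infinity almost surely (`ae_tendsto_card_dist_le`).

They are indistinguishable from user 1: the `χ²` divergence between the laws of two paths of length
`M` is at most `exp (C * M * n ^ (-2β)) - 1`, which tends to zero because `m` grows more slowly than
`n ^ (2β)` (`exists_sum_abs_pathWeight_sub_le`).

This gives privacy: the uniform permutation makes the observation `Y` symmetric under exchanging two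
users, so for `j` in the crowd `J` the covariance of `h (Z j)` with a bounded function of `Y` is
almost that for user 1. It is thus almost the average over `J`, and an average of independent
centred variables is of size `1 / √|J|` (`abs_integral_mul_sub_le`). Hence the joint law of `X_1(k)`
and `Y` is `ℓ¹`-close to the product law. Since `X_1(k)` has a fixed finite range, `ℓ¹`-closeness
controls the mutual information whatever the size of the range of `Y` (`mutualInfo_le_sum`). -/

/-! ### Mutual information and `ℓ¹` distance from independence -/

theorem InformationTheory.klFun_le_sub_one_sq {x : ℝ} (hx : 0 ≤ x) :
    InformationTheory.klFun x ≤ (x - 1) ^ 2 := by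
  rcases hx.eq_or_lt with rfl | hx
  · simp [InformationTheory.klFun]
  · have h := mul_le_mul_of_nonneg_left (Real.log_le_sub_one_of_pos hx) hx.le
    unfold InformationTheory.klFun
    nlinarith

theorem klDiv_le_sum_sub_one_sq {α : Type*} [Fintype α] [MeasurableSpace α]
    [MeasurableSingletonClass α] (μ ν : Measure α) [IsFiniteMeasure μ] [IsFiniteMeasure ν]
    (hac : μ ≪ ν) :
    InformationTheory.klDiv μ ν ≤
      ENNReal.ofReal (∑ a, ((μ.rnDeriv ν a).toReal - 1) ^ 2 * ν.real {a}) := by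
  rw [InformationTheory.klDiv_eq_lintegral_klFun_of_ac hac, lintegral_fintype,
    ENNReal.ofReal_sum_of_nonneg fun a _ => by positivity]
  refine Finset.sum_le_sum fun a _ => ?_
  rw [ENNReal.ofReal_mul (sq_nonneg _), ofReal_measureReal]
  gcongr
  exact InformationTheory.klFun_le_sub_one_sq ENNReal.toReal_nonneg

theorem rnDeriv_toReal_mul_real_singleton {α : Type*} [MeasurableSpace α]
    [MeasurableSingletonClass α] (μ ν : Measure α) [IsFiniteMeasure μ] [IsFiniteMeasure ν]
    (hac : μ ≪ ν) (a : α) :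
    (μ.rnDeriv ν a).toReal * ν.real {a} = μ.real {a} := by
  have h := Measure.setLIntegral_rnDeriv hac {a}
  rw [lintegral_singleton] at h
  rw [measureReal_def, measureReal_def, ← h, ENNReal.toReal_mul]

/-- The joint mass of `(x, y)` is at most the mass of `y`, so the density `ρ` of the joint law
against the product law satisfies `ρ * p ≤ 1`, where `p` is the mass of `x`. Thus `|ρ - 1| ≤ p⁻¹`,
and one factor of `(ρ - 1) ^ 2` in the `χ²` bound is traded for `p⁻¹`. No constant depends on the
size of `T`, which grows with `n` in the application. -/
theorem mutualInfo_le_sum {Ω S T : Type*} [MeasurableSpace Ω] [Fintype S] [Fintype T]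
    [MeasurableSpace S] [MeasurableSingletonClass S]
    [MeasurableSpace T] [MeasurableSingletonClass T] (Q : Measure Ω) [IsProbabilityMeasure Q]
    {U : Ω → S} {V : Ω → T} (hU : Measurable U) (hV : Measurable V) :
    mutualInfo Q U V ≤ ENNReal.ofReal (∑ x, (Q.real (U ⁻¹' {x}))⁻¹ *
      ∑ y, |Q.real (U ⁻¹' {x} ∩ V ⁻¹' {y}) - Q.real (U ⁻¹' {x}) * Q.real (V ⁻¹' {y})|) := by
  have hUV : Measurable fun ω => (U ω, V ω) := hU.prodMk hV
  have : IsProbabilityMeasure (Q.map U) := Measure.isProbabilityMeasure_map hU.aemeasurable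
  have : IsProbabilityMeasure (Q.map V) := Measure.isProbabilityMeasure_map hV.aemeasurable
  have : IsProbabilityMeasure (Q.map fun ω => (U ω, V ω)) :=
    Measure.isProbabilityMeasure_map hUV.aemeasurable
  set J := Q.map fun ω => (U ω, V ω) with hJ
  set K := (Q.map U).prod (Q.map V) with hK
  have hJs : ∀ x y, J.real {(x, y)} = Q.real (U ⁻¹' {x} ∩ V ⁻¹' {y}) := by
    intro x y
    rw [hJ, map_measureReal_apply hUV (measurableSet_singleton _)]
    congr 1
    ext ω
    simp
  have hKs : ∀ x y, K.real {(x, y)} = Q.real (U ⁻¹' {x}) * Q.real (V ⁻¹' {y}) := by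
    intro x y
    rw [hK, ← Set.singleton_prod_singleton, measureReal_prod_prod,
      map_measureReal_apply hU (measurableSet_singleton _),
      map_measureReal_apply hV (measurableSet_singleton _)]
  have hle : ∀ x y, J.real {(x, y)} ≤ Q.real (U ⁻¹' {x}) ∧ J.real {(x, y)} ≤ Q.real (V ⁻¹' {y}) := by
    intro x y
    rw [hJs]
    exact ⟨measureReal_mono Set.inter_subset_left, measureReal_mono Set.inter_subset_right⟩
  have hac : J ≪ K := by
    refine Measure.AbsolutelyContinuous.mk fun s _ hs => ?_
    rw [← Set.biUnion_of_singleton s, measure_biUnion_null_iff s.to_countable]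
    rintro ⟨x, y⟩ hxy
    have h0 : K.real {(x, y)} = 0 := by
      rw [measureReal_def, measure_mono_null (Set.singleton_subset_iff.2 hxy) hs]; rfl
    have h1 : J.real {(x, y)} = 0 := by
      rw [hKs, mul_eq_zero] at h0
      have := hle x y
      have := measureReal_nonneg (μ := J) (s := {(x, y)})
      rcases h0 with h0 | h0 <;> linarith
    rwa [measureReal_eq_zero_iff] at h1
  refine (klDiv_le_sum_sub_one_sq J K hac).trans (ENNReal.ofReal_le_ofReal ?_)
  rw [Fintype.sum_prod_type]
  refine Finset.sum_le_sum fun x _ => ?_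
  rw [Finset.mul_sum]
  refine Finset.sum_le_sum fun y _ => ?_
  have hρ := rnDeriv_toReal_mul_real_singleton J K hac (x, y)
  rw [← hJs, ← hKs, ← hρ]
  have hK0 : 0 ≤ K.real {(x, y)} := measureReal_nonneg
  have hρ0 : 0 ≤ (J.rnDeriv K (x, y)).toReal := ENNReal.toReal_nonneg
  -- Cells of product mass zero contribute nothing, so the value `0⁻¹ = 0` does no harm.
  rcases hK0.eq_or_lt with h0 | hpos
  · simp [← h0]
  have hKxy := hKs x y
  set ρ := (J.rnDeriv K (x, y)).toReal
  set p := Q.real (U ⁻¹' {x}) with hp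
  set q := Q.real (V ⁻¹' {y})
  have hp0 : 0 ≤ p := measureReal_nonneg
  have hq0 : 0 ≤ q := measureReal_nonneg
  have hp1 : p ≤ 1 := measureReal_le_one
  have hpp : 0 < p := by
    rcases hp0.eq_or_lt with h | h
    · rw [hKxy, ← h, zero_mul] at hpos; exact absurd hpos (lt_irrefl _)
    · exact h
  have hqq : 0 < q := by
    rcases hq0.eq_or_lt with h | h
    · rw [hKxy, ← h, mul_zero] at hpos; exact absurd hpos (lt_irrefl _)
    · exact h
  have hρp : ρ * p ≤ 1 := by
    have := (hle x y).2
    rw [← hρ, hKxy, ← mul_assoc] at this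
    exact le_of_mul_le_mul_right (by linarith) hqq
  have habs : |ρ - 1| ≤ p⁻¹ := by
    have : |ρ - 1| * p ≤ 1 := by
      rcases abs_cases (ρ - 1) with ⟨h, _⟩ | ⟨h, _⟩ <;> rw [h] <;> nlinarith
    rwa [← one_div, le_div_iff₀ hpp]
  have : ρ * K.real {(x, y)} - K.real {(x, y)} = (ρ - 1) * K.real {(x, y)} := by ring
  rw [this, abs_mul, abs_of_pos hpos, ← mul_assoc, ← sq_abs, sq]
  gcongr

/-! ### Products of finite distributions -/

theorem sum_prod_apply_eq_prod_sum {ι S : Type*} [Fintype ι] [DecidableEq ι] [Fintype S]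
    (c : ι → S → ℝ) : ∑ z : ι → S, ∏ i, c i (z i) = ∏ i, ∑ s, c i s := by
  rw [Finset.prod_univ_sum]
  simp

/-- The `ℓ¹` distance between product distributions is at most the sum of the `ℓ¹` distances
between the factors. -/
theorem sum_abs_prod_sub_prod_le {ι S : Type*} [Fintype ι] [DecidableEq ι] [Fintype S]
    {a b : ι → S → ℝ} (ha0 : ∀ i s, 0 ≤ a i s) (hb0 : ∀ i s, 0 ≤ b i s)
    (ha1 : ∀ i, ∑ s, a i s = 1) (hb1 : ∀ i, ∑ s, b i s = 1) :
    ∑ z : ι → S, |∏ i, a i (z i) - ∏ i, b i (z i)| ≤ ∑ i, ∑ s, |a i s - b i s| := by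
  -- Hybrid argument: the factors `b i` are replaced by `a i` one coordinate at a time.
  have key : ∀ t : Finset ι,
      ∑ z : ι → S, |∏ i, (if i ∈ t then a i (z i) else b i (z i)) - ∏ i, b i (z i)| ≤
        ∑ i ∈ t, ∑ s, |a i s - b i s| := by
    intro t
    induction t using Finset.induction_on with
    | empty => simp
    | insert j t hj ih =>
      rw [Finset.sum_insert hj]
      have hstep : ∑ z : ι → S, |∏ i, (if i ∈ insert j t then a i (z i) else b i (z i)) -
          ∏ i, (if i ∈ t then a i (z i) else b i (z i))| = ∑ s, |a j s - b j s| := by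
        -- Consecutive hybrids differ only in the factor `j`, so the absolute difference is again a
        -- product, whose other factors sum to one.
        have hpt : ∀ z : ι → S, |∏ i, (if i ∈ insert j t then a i (z i) else b i (z i)) -
            ∏ i, (if i ∈ t then a i (z i) else b i (z i))| =
            ∏ i, (fun i s => if i = j then |a i s - b i s| else
              if i ∈ t then a i s else b i s) i (z i) := by
          intro z
          rw [← Finset.mul_prod_erase _ _ (Finset.mem_univ j),
            ← Finset.mul_prod_erase _ _ (Finset.mem_univ j),
            ← Finset.mul_prod_erase _ (fun i => (fun i s => if i = j then |a i s - b i s| else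
              if i ∈ t then a i s else b i s) i (z i)) (Finset.mem_univ j)]
          have h1 : ∏ i ∈ Finset.univ.erase j, (if i ∈ insert j t then a i (z i) else b i (z i)) =
              ∏ i ∈ Finset.univ.erase j, (if i ∈ t then a i (z i) else b i (z i)) := by
            refine Finset.prod_congr rfl fun i hi => ?_
            simp [Finset.ne_of_mem_erase hi]
          have h2 : ∏ i ∈ Finset.univ.erase j, (fun i s => if i = j then |a i s - b i s| else
              if i ∈ t then a i s else b i s) i (z i) =
              ∏ i ∈ Finset.univ.erase j, (if i ∈ t then a i (z i) else b i (z i)) := by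
            refine Finset.prod_congr rfl fun i hi => ?_
            simp [Finset.ne_of_mem_erase hi]
          rw [h1, h2, ← sub_mul, abs_mul, abs_of_nonneg (a := ∏ i ∈ Finset.univ.erase j, _)]
          · simp [hj]
          · exact Finset.prod_nonneg fun i _ => by split_ifs; exacts [ha0 _ _, hb0 _ _]
        refine ((Finset.sum_congr rfl fun z _ => hpt z).trans (sum_prod_apply_eq_prod_sum
          fun i s => if i = j then |a i s - b i s| else if i ∈ t then a i s else b i s)).trans ?_
        rw [Finset.prod_eq_single j]
        · simp
        · intro i _ hi
          simp only [hi, if_false]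
          split_ifs
          exacts [ha1 i, hb1 i]
        · simp
      calc _ ≤ ∑ z : ι → S, (|∏ i, (if i ∈ insert j t then a i (z i) else b i (z i)) -
            ∏ i, (if i ∈ t then a i (z i) else b i (z i))| +
            |∏ i, (if i ∈ t then a i (z i) else b i (z i)) - ∏ i, b i (z i)|) :=
            Finset.sum_le_sum fun z _ => abs_sub_le _ _ _
        _ ≤ _ := by
          rw [Finset.sum_add_distrib, hstep]
          gcongr
  simpa using key Finset.univ

/-! ### Anonymity among users with nearly equal laws -/

section Anonymity

variable {Ω S : Type*} [MeasurableSpace Ω] [Fintype S] [MeasurableSpace S]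
  [MeasurableSingletonClass S] {Q : Measure Ω} [IsProbabilityMeasure Q] {n : ℕ}
  {Z : Fin n → Ω → S} {Pm : Ω → Equiv.Perm (Fin n)}

theorem integral_comp_eq_sum {T : Type*} [Fintype T] [MeasurableSpace T]
    [MeasurableSingletonClass T] {V : Ω → T} (hV : Measurable V) (F : T → ℝ) :
    ∫ ω, F (V ω) ∂Q = ∑ v, Q.real (V ⁻¹' {v}) * F v := by
  have : IsProbabilityMeasure (Q.map V) := Measure.isProbabilityMeasure_map hV.aemeasurable
  rw [← integral_map hV.aemeasurable (Measurable.of_discrete).aestronglyMeasurable,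
    integral_fintype Integrable.of_finite]
  refine Finset.sum_congr rfl fun v _ => ?_
  rw [map_measureReal_apply hV (measurableSet_singleton _), smul_eq_mul]

theorem sum_real_preimage_singleton {T : Type*} [Fintype T] [MeasurableSpace T]
    [MeasurableSingletonClass T] {V : Ω → T} (hV : Measurable V) :
    ∑ v, Q.real (V ⁻¹' {v}) = 1 := by
  have := integral_comp_eq_sum (Q := Q) hV fun _ => 1
  simpa using this.symm

/-- Expectations of functions of a uniform permutation and of independent paths. -/
theorem integral_perm_paths_eq_sum (hZ : ∀ i, Measurable (Z i)) (hZi : iIndepFun Z Q)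
    (hPm : Measurable Pm) (hunif : ∀ π, Q {ω | Pm ω = π} = (n.factorial : ℝ≥0∞)⁻¹)
    (hind : IndepFun Pm (fun ω i => Z i ω) Q) (F : Equiv.Perm (Fin n) → (Fin n → S) → ℝ) :
    ∫ ω, F (Pm ω) (fun i => Z i ω) ∂Q =
      ∑ π, ∑ z : Fin n → S, (n.factorial : ℝ)⁻¹ * (∏ i, Q.real (Z i ⁻¹' {z i})) * F π z := by
  have : MeasurableSingletonClass (Equiv.Perm (Fin n)) := ⟨fun _ => trivial⟩
  have hZm : Measurable fun ω i => Z i ω := measurable_pi_iff.2 hZ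
  have h := integral_comp_eq_sum (Q := Q) (hPm.prodMk hZm) fun p => F p.1 p.2
  simp only at h
  rw [h, Fintype.sum_prod_type]
  refine Finset.sum_congr rfl fun π _ => Finset.sum_congr rfl fun z _ => ?_
  congr 1
  have h1 : (fun ω => (Pm ω, fun i => Z i ω)) ⁻¹' {(π, z)} =
      Pm ⁻¹' {π} ∩ (fun ω i => Z i ω) ⁻¹' {z} := by
    ext ω; simp
  have h2 : (fun ω i => Z i ω) ⁻¹' {z} = ⋂ i, Z i ⁻¹' {z i} := by
    ext ω; simp [funext_iff]
  rw [h1, measureReal_def, hind.measure_inter_preimage_eq_mul _ _ (measurableSet_singleton _)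
    (measurableSet_singleton _), h2, hZi.meas_iInter fun i => ⟨{z i}, measurableSet_singleton _, rfl⟩,
    ENNReal.toReal_mul, ENNReal.toReal_prod]
  congr 1
  have := hunif π
  rw [show Pm ⁻¹' {π} = {ω | Pm ω = π} from rfl, this]
  simp

/-- Swapping two users with nearly equal laws is nearly invisible to the observer. -/
theorem abs_integral_sub_integral_swap_le (hZ : ∀ i, Measurable (Z i)) (hZi : iIndepFun Z Q)
    (hPm : Measurable Pm) (hunif : ∀ π, Q {ω | Pm ω = π} = (n.factorial : ℝ≥0∞)⁻¹)
    (hind : IndepFun Pm (fun ω i => Z i ω) Q) {h : S → ℝ} (hh : ∀ s, |h s| ≤ 1)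
    {g : (Fin n → S) → ℝ} (hg : ∀ y, |g y| ≤ 1) (i j : Fin n) :
    |∫ ω, h (Z i ω) * g (fun v => Z ((Pm ω).symm v) ω) ∂Q -
        ∫ ω, h (Z j ω) * g (fun v => Z ((Pm ω).symm v) ω) ∂Q| ≤
      2 * ∑ s, |Q.real (Z i ⁻¹' {s}) - Q.real (Z j ⁻¹' {s})| := by
  set ν : Fin n → S → ℝ := fun k s => Q.real (Z k ⁻¹' {s}) with hν
  set σ : Equiv.Perm (Fin n) := Equiv.swap i j
  have hE : ∀ k, ∫ ω, h (Z k ω) * g (fun v => Z ((Pm ω).symm v) ω) ∂Q =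
      ∑ π : Equiv.Perm (Fin n), ∑ z : Fin n → S, (n.factorial : ℝ)⁻¹ * (∏ l, ν l (z l)) *
        (h (z k) * g (fun v => z (π.symm v))) := fun k =>
    integral_perm_paths_eq_sum hZ hZi hPm hunif hind
      fun π z => h (z k) * g (fun v => z (π.symm v))
  have hν1 : ∀ k, ∑ s, ν k s = 1 := fun k => sum_real_preimage_singleton (hZ k)
  -- Substituting `π * σ` for `π` and `z ∘ σ` for `z` leaves the observed paths unchanged; it
  -- exchanges the roles of `i` and `j` in `h` and permutes the laws.
  have hswap : ∫ ω, h (Z i ω) * g (fun v => Z ((Pm ω).symm v) ω) ∂Q =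
      ∑ π : Equiv.Perm (Fin n), ∑ z : Fin n → S, (n.factorial : ℝ)⁻¹ * (∏ l, ν (σ l) (z l)) *
        (h (z j) * g (fun v => z (π.symm v))) := by
    rw [hE, ← Equiv.sum_comp (Equiv.mulRight σ)]
    refine Finset.sum_congr rfl fun π _ => ?_
    rw [← Equiv.sum_comp (Equiv.arrowCongr σ (Equiv.refl S))]
    refine Finset.sum_congr rfl fun z _ => ?_
    have hprod : ∏ l, ν l (z (σ l)) = ∏ l, ν (σ l) (z l) := by
      rw [← Equiv.prod_comp σ]
      simp [σ]
    simp only [Equiv.arrowCongr_apply, Equiv.coe_refl, Function.comp_apply, id_eq,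
      Equiv.coe_mulRight]
    have hσ : ∀ l, σ.symm l = σ l := fun l => by simp [σ]
    simp only [hσ, hprod]
    congr 3
    · simp [σ]
    · funext v
      congr 1
      change σ ((π * σ)⁻¹ v) = _
      rw [mul_inv_rev, Equiv.Perm.mul_apply, Equiv.Perm.inv_def σ, Equiv.apply_symm_apply]
      rfl
  have hL1 : ∑ z : Fin n → S, |∏ l, ν (σ l) (z l) - ∏ l, ν l (z l)| ≤
      2 * ∑ s, |ν i s - ν j s| := by
    refine (sum_abs_prod_sub_prod_le (fun _ _ => measureReal_nonneg)
      (fun _ _ => measureReal_nonneg) (fun l => hν1 (σ l)) hν1).trans ?_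
    by_cases hij : i = j
    · subst hij
      simp [σ]
    calc ∑ l, ∑ s, |ν (σ l) s - ν l s|
        = ∑ l ∈ {i, j}, ∑ s, |ν (σ l) s - ν l s| := by
          refine (Finset.sum_subset (Finset.subset_univ _) fun l _ hl => ?_).symm
          simp only [Finset.mem_insert, Finset.mem_singleton, not_or] at hl
          simp [σ, Equiv.swap_apply_of_ne_of_ne hl.1 hl.2]
      _ ≤ 2 * ∑ s, |ν i s - ν j s| := by
          rw [Finset.sum_pair hij]
          simp only [σ, Equiv.swap_apply_left, Equiv.swap_apply_right]
          rw [two_mul]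
          simp only [abs_sub_comm (ν j _)]
          exact le_refl _
  rw [hswap, hE, ← Finset.sum_sub_distrib]
  calc _ ≤ ∑ π : Equiv.Perm (Fin n), (n.factorial : ℝ)⁻¹ * (2 * ∑ s, |ν i s - ν j s|) := by
        refine (Finset.abs_sum_le_sum_abs _ _).trans (Finset.sum_le_sum fun π _ => ?_)
        rw [← Finset.sum_sub_distrib]
        refine (Finset.abs_sum_le_sum_abs _ _).trans ?_
        refine le_trans (Finset.sum_le_sum fun z _ => ?_)
          ((Finset.mul_sum _ _ _).symm.le.trans (mul_le_mul_of_nonneg_left hL1 (by positivity)))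
        rw [← sub_mul, ← mul_sub, abs_mul, abs_mul, abs_of_nonneg (by positivity), abs_mul]
        refine mul_le_of_le_one_right (by positivity) ?_
        exact mul_le_one₀ (hh _) (abs_nonneg _) (hg _)
    _ = _ := by
        rw [Finset.sum_const, Finset.card_univ, Fintype.card_perm, Fintype.card_fin, nsmul_eq_mul,
          ← mul_assoc, mul_inv_cancel₀ (by positivity), one_mul]

/-- Independence makes the variance additive, and each summand has variance at most `1 / 4`; the
`L¹` norm is then bounded by the `L²` norm. -/
theorem integral_abs_sum_sub_le (hZ : ∀ i, Measurable (Z i)) (hZi : iIndepFun Z Q)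
    {h : S → ℝ} (hh0 : ∀ s, 0 ≤ h s) (hh1 : ∀ s, h s ≤ 1) (J : Finset (Fin n)) :
    ∫ ω, |∑ i ∈ J, (h (Z i ω) - ∫ ω, h (Z i ω) ∂Q)| ∂Q ≤ √J.card := by
  have hm : ∀ i, Measurable fun ω => h (Z i ω) := fun i =>
    (Measurable.of_discrete (f := h)).comp (hZ i)
  have hb : ∀ i, MemLp (fun ω => h (Z i ω)) 2 Q := fun i =>
    MemLp.of_bound (hm i).aestronglyMeasurable 1
      (ae_of_all _ fun ω => by rw [Real.norm_eq_abs, abs_of_nonneg (hh0 _)]; exact hh1 _)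
  set W : Ω → ℝ := ∑ i ∈ J, fun ω => h (Z i ω) with hW
  have hWL : MemLp W 2 Q := memLp_finsetSum' _ fun i _ => hb i
  have hWm : ∫ ω, W ω ∂Q = ∑ i ∈ J, ∫ ω, h (Z i ω) ∂Q := by
    simp only [hW, Finset.sum_apply]
    exact integral_finsetSum _ fun i _ => (hb i).integrable (by norm_num)
  have hvar : variance W Q ≤ J.card := by
    rw [hW, IndepFun.variance_sum (fun i _ => hb i)]
    · calc _ ≤ ∑ i ∈ J, ((1 - 0) / 2 : ℝ) ^ 2 := Finset.sum_le_sum fun i _ =>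
            variance_le_sq_of_bounded (ae_of_all _ fun ω => ⟨hh0 _, hh1 _⟩) (hm i).aemeasurable
        _ ≤ _ := by
          rw [Finset.sum_const, nsmul_eq_mul]
          nlinarith [Nat.cast_nonneg (α := ℝ) J.card]
    · intro i _ j _ hij
      exact (hZi.indepFun hij).comp (Measurable.of_discrete (f := h))
        (Measurable.of_discrete (f := h))
  have heq : ∀ ω, ∑ i ∈ J, (h (Z i ω) - ∫ ω, h (Z i ω) ∂Q) = W ω - ∫ ω, W ω ∂Q := by
    intro ω
    rw [hWm, Finset.sum_sub_distrib]
    simp [hW]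
  simp only [heq]
  have hV : MemLp (fun ω => W ω - ∫ ω, W ω ∂Q) 2 Q := hWL.sub (memLp_const _)
  refine Real.le_sqrt_of_sq_le (le_trans ?_ hvar)
  rw [variance_eq_integral hWL.aemeasurable]
  -- Nonnegativity of the variance of `|V|` is the inequality `(∫ |V|) ^ 2 ≤ ∫ V ^ 2`.
  have h0 := variance_nonneg (fun ω => |W ω - ∫ ω, W ω ∂Q|) Q
  rw [show (fun ω => |W ω - ∫ ω, W ω ∂Q|) = |fun ω => W ω - ∫ ω, W ω ∂Q| from rfl,
    variance_eq_sub hV.abs] at h0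
  simp only [Pi.abs_apply, Pi.pow_apply, sq_abs] at h0
  linarith

/-- If the laws of the users in a set `J` are all close to that of user `i`, then what the observer
sees is nearly independent of the path of user `i`. -/
theorem abs_integral_mul_sub_le (hZ : ∀ i, Measurable (Z i)) (hZi : iIndepFun Z Q)
    (hPm : Measurable Pm) (hunif : ∀ π, Q {ω | Pm ω = π} = (n.factorial : ℝ≥0∞)⁻¹)
    (hind : IndepFun Pm (fun ω i => Z i ω) Q) {h : S → ℝ} (hh0 : ∀ s, 0 ≤ h s)
    (hh1 : ∀ s, h s ≤ 1) {g : (Fin n → S) → ℝ} (hg : ∀ y, |g y| ≤ 1) (i : Fin n)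
    (J : Finset (Fin n)) (hJ : J.Nonempty) {η : ℝ}
    (hη : ∀ j ∈ J, ∑ s, |Q.real (Z i ⁻¹' {s}) - Q.real (Z j ⁻¹' {s})| ≤ η) :
    |∫ ω, (h (Z i ω) - ∫ ω, h (Z i ω) ∂Q) * g (fun v => Z ((Pm ω).symm v) ω) ∂Q| ≤
      3 * η + 1 / √J.card := by
  have : MeasurableSingletonClass (Equiv.Perm (Fin n)) := ⟨fun _ => trivial⟩
  have hZm : Measurable fun ω i => Z i ω := measurable_pi_iff.2 hZ
  have hhabs : ∀ s, |h s| ≤ 1 := fun s => by rw [abs_of_nonneg (hh0 s)]; exact hh1 s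
  have hint : ∀ F : Equiv.Perm (Fin n) × (Fin n → S) → ℝ,
      Integrable (fun ω => F (Pm ω, fun i => Z i ω)) Q := by
    intro F
    have : IsProbabilityMeasure (Q.map fun ω => (Pm ω, fun i => Z i ω)) :=
      Measure.isProbabilityMeasure_map (hPm.prodMk hZm).aemeasurable
    exact (Integrable.of_finite (f := F)).comp_measurable (hPm.prodMk hZm)
  set G : Ω → ℝ := fun ω => g (fun v => Z ((Pm ω).symm v) ω) with hG
  set p : Fin n → ℝ := fun k => ∫ ω, h (Z k ω) ∂Q with hp
  have hpη : ∀ j ∈ J, |p j - p i| ≤ η := by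
    intro j hj
    refine le_trans ?_ (hη j hj)
    simp only [hp]
    rw [integral_comp_eq_sum (hZ j), integral_comp_eq_sum (hZ i), ← Finset.sum_sub_distrib]
    refine (Finset.abs_sum_le_sum_abs _ _).trans (Finset.sum_le_sum fun s _ => ?_)
    rw [← sub_mul, abs_mul, abs_sub_comm]
    exact mul_le_of_le_one_right (abs_nonneg _) (hhabs s)
  have hGi : Integrable G Q := hint fun q => g (fun v => q.2 (q.1.symm v))
  have hhG : ∀ k, Integrable (fun ω => h (Z k ω) * G ω) Q := fun k =>
    hint fun q => h (q.2 k) * g (fun v => q.2 (q.1.symm v))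
  have hG1 : |∫ ω, G ω ∂Q| ≤ 1 := by
    have := norm_integral_le_of_norm_le_const (μ := Q) (f := G) (C := 1)
      (ae_of_all _ fun ω => hg _)
    simpa using this
  have hN : (0 : ℝ) < J.card := by exact_mod_cast hJ.card_pos
  have hcard : ∀ x : ℝ, ∑ _j ∈ J, x = J.card * x := fun x => by simp
  -- User `i` is compared with each `j` in `J`: the swap costs `2 * η`, the change of mean costs
  -- `η`, and a sum of independent centred variables remains.
  have hsplit : J.card * ∫ ω, (h (Z i ω) - p i) * G ω ∂Q =
      ∑ j ∈ J, ((∫ ω, h (Z i ω) * G ω ∂Q - ∫ ω, h (Z j ω) * G ω ∂Q) +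
        (p j - p i) * ∫ ω, G ω ∂Q) + ∫ ω, (∑ j ∈ J, (h (Z j ω) - p j)) * G ω ∂Q := by
    have e1 : ∫ ω, (h (Z i ω) - p i) * G ω ∂Q = ∫ ω, h (Z i ω) * G ω ∂Q - p i * ∫ ω, G ω ∂Q := by
      simp only [sub_mul]
      rw [integral_sub (hhG i) (hGi.const_mul _), integral_const_mul]
    have e2 : ∫ ω, (∑ j ∈ J, (h (Z j ω) - p j)) * G ω ∂Q =
        ∑ j ∈ J, (∫ ω, h (Z j ω) * G ω ∂Q - p j * ∫ ω, G ω ∂Q) := by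
      simp only [Finset.sum_mul, sub_mul]
      rw [integral_finsetSum J fun j _ => show Integrable (fun ω => h (Z j ω) * G ω - p j * G ω) Q from
        (hhG j).sub (hGi.const_mul _)]
      refine Finset.sum_congr rfl fun j _ => ?_
      rw [integral_sub (hhG j) (hGi.const_mul _), integral_const_mul]
    rw [e1, e2, ← Finset.sum_add_distrib, ← hcard]
    exact Finset.sum_congr rfl fun j _ => by ring
  have hb1 : |∑ j ∈ J, ((∫ ω, h (Z i ω) * G ω ∂Q - ∫ ω, h (Z j ω) * G ω ∂Q) +
        (p j - p i) * ∫ ω, G ω ∂Q)| ≤ J.card * (3 * η) := by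
    rw [← hcard]
    refine (Finset.abs_sum_le_sum_abs _ _).trans (Finset.sum_le_sum fun j hj => ?_)
    have s1 := abs_integral_sub_integral_swap_le hZ hZi hPm hunif hind hhabs hg i j
    have s2 := hη j hj
    have s3 : |(p j - p i) * ∫ ω, G ω ∂Q| ≤ η := by
      rw [abs_mul]
      exact (mul_le_of_le_one_right (abs_nonneg _) hG1).trans (hpη j hj)
    refine (abs_add_le _ _).trans ?_
    simp only [hG] at s3 ⊢
    linarith
  have hb2 : |∫ ω, (∑ j ∈ J, (h (Z j ω) - p j)) * G ω ∂Q| ≤ √J.card := by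
    refine (abs_integral_le_integral_abs).trans
      (le_trans ?_ (integral_abs_sum_sub_le hZ hZi hh0 hh1 J))
    refine integral_mono
      (hint fun q => |(∑ j ∈ J, (h (q.2 j) - p j)) * g (fun v => q.2 (q.1.symm v))|)
      (hint fun q => |∑ j ∈ J, (h (q.2 j) - p j)|) fun ω => ?_
    simp only [abs_mul]
    exact mul_le_of_le_one_right (abs_nonneg _) (hg _)
  have hfin : J.card * |∫ ω, (h (Z i ω) - p i) * G ω ∂Q| ≤ J.card * (3 * η + 1 / √J.card) := by
    rw [← abs_of_pos hN, ← abs_mul, hsplit, abs_of_pos hN]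
    refine (abs_add_le _ _).trans ?_
    rw [mul_add, mul_one_div, Real.div_sqrt]
    linarith
  exact le_of_mul_le_mul_left hfin hN

end Anonymity

/-- The weight of a path `z` of length `M` started at `s`, for edge weights `w`; for a transition
matrix this is the law of the path of the Markov chain. -/
def pathWeight {r : ℕ} (w : Matrix (Fin r) (Fin r) ℝ) (s : Fin r) {M : ℕ}
    (z : Fin (M + 1) → Fin r) : ℝ :=
  if z 0 = s then ∏ t : Fin M, w (z t.castSucc) (z t.succ) else 0

/-! ### Path laws and their `χ²` divergence -/

section PathWeight

variable {r : ℕ} {w A B : Matrix (Fin r) (Fin r) ℝ}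

theorem sum_pathWeight_succ (w : Matrix (Fin r) (Fin r) ℝ) (s : Fin r) (M : ℕ) :
    ∑ z : Fin (M + 1 + 1) → Fin r, pathWeight w s z =
      ∑ j, w s j * ∑ z : Fin (M + 1) → Fin r, pathWeight w j z := by
  rw [← (Fin.consEquiv fun _ => Fin r).sum_comp, Fintype.sum_prod_type, Finset.sum_eq_single s]
  · simp only [Finset.mul_sum]
    rw [Finset.sum_comm]
    refine Finset.sum_congr rfl fun z _ => ?_
    rw [Finset.sum_eq_single (z 0)]
    · simp [pathWeight, Fin.consEquiv, Fin.prod_univ_succ]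
    · intro j _ hj
      simp [pathWeight, hj.symm]
    · simp
  · intro a _ ha
    simp [pathWeight, Fin.consEquiv, ha]
  · simp

theorem sum_pathWeight_zero (w : Matrix (Fin r) (Fin r) ℝ) (s : Fin r) :
    ∑ z : Fin (0 + 1) → Fin r, pathWeight w s z = 1 := by
  rw [← (Equiv.funUnique (Fin 1) (Fin r)).symm.sum_comp]
  simp [pathWeight]

theorem sum_pathWeight_le {K : ℝ} (hw : ∀ i j, 0 ≤ w i j) (hK : ∀ i, ∑ j, w i j ≤ K) (s : Fin r)
    (M : ℕ) : ∑ z : Fin (M + 1) → Fin r, pathWeight w s z ≤ K ^ M := by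
  have hK0 : 0 ≤ K := (Finset.sum_nonneg fun j _ => hw s j).trans (hK s)
  induction M generalizing s with
  | zero => rw [sum_pathWeight_zero, pow_zero]
  | succ M ih =>
    rw [sum_pathWeight_succ, pow_succ']
    calc _ ≤ ∑ j, w s j * K ^ M :=
          Finset.sum_le_sum fun j _ => mul_le_mul_of_nonneg_left (ih j) (hw s j)
      _ ≤ _ := by
        rw [← Finset.sum_mul]
        exact mul_le_mul_of_nonneg_right (hK s) (by positivity)

theorem sum_pathWeight_eq_one (hw : ∀ i, ∑ j, w i j = 1) (s : Fin r) (M : ℕ) :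
    ∑ z : Fin (M + 1) → Fin r, pathWeight w s z = 1 := by
  induction M generalizing s with
  | zero => exact sum_pathWeight_zero _ _
  | succ M ih => simp [sum_pathWeight_succ, ih, hw]

theorem pathWeight_nonneg (hw : ∀ i j, 0 ≤ w i j) (s : Fin r) {M : ℕ} (z : Fin (M + 1) → Fin r) :
    0 ≤ pathWeight w s z := by
  unfold pathWeight
  split_ifs
  · exact Finset.prod_nonneg fun _ _ => hw _ _
  · exact le_rfl

/-- The `ℓ¹` distance between finite distributions is bounded through their `χ²` divergence. -/
theorem sum_abs_sub_sq_le_chiSq {S : Type*} [Fintype S] {a b : S → ℝ} (ha : ∀ s, 0 ≤ a s)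
    (hab : ∀ s, a s = 0 → b s = 0) (ha1 : ∑ s, a s = 1) (hb1 : ∑ s, b s = 1) :
    (∑ s, |a s - b s|) ^ 2 ≤ ∑ s, b s ^ 2 / a s - 1 := by
  have h := Finset.sum_sq_le_sum_mul_sum_of_sq_le_mul Finset.univ (r := fun s => |a s - b s|)
    (f := a) (g := fun s => (a s - b s) ^ 2 / a s) (fun s _ => ha s)
    (fun s _ => div_nonneg (sq_nonneg _) (ha s)) (fun s _ => by
      rcases eq_or_ne (a s) 0 with h | h
      · simp [h, hab s h]
      · rw [sq_abs, mul_div_cancel₀ _ h])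
  rw [ha1, one_mul] at h
  refine h.trans (le_of_eq ?_)
  have hpt : ∀ s, (a s - b s) ^ 2 / a s = a s - 2 * b s + b s ^ 2 / a s := by
    intro s
    rcases eq_or_ne (a s) 0 with h | h
    · simp [h, hab s h]
    · field_simp
      ring
  simp only [hpt, Finset.sum_add_distrib, Finset.sum_sub_distrib, ← Finset.mul_sum, ha1, hb1]
  ring

/-- The `χ²` sum over paths is itself a total path weight, with edge weights `B ^ 2 / A`, so it is
at most the `M`-th power of a bound for the row sums. These exceed one only by a term quadratic in
`D`. -/
theorem sum_abs_pathWeight_sub_le (hA0 : ∀ i j, 0 ≤ A i j) (hAB : ∀ i j, A i j = 0 → B i j = 0)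
    (hA1 : ∀ i, ∑ j, A i j = 1) (hB1 : ∀ i, ∑ j, B i j = 1) {D : ℝ}
    (hD : ∀ i j, |A i j - B i j| ≤ D) (s : Fin r) (M : ℕ) :
    ∑ z : Fin (M + 1) → Fin r, |pathWeight A s z - pathWeight B s z| ≤
      √((1 + (∑ i, ∑ j, (A i j)⁻¹) * D ^ 2) ^ M - 1) := by
  refine Real.le_sqrt_of_sq_le ?_
  refine (sum_abs_sub_sq_le_chiSq (pathWeight_nonneg hA0 s) ?_ (sum_pathWeight_eq_one hA1 s M)
    (sum_pathWeight_eq_one hB1 s M)).trans ?_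
  · intro z hz
    unfold pathWeight at hz ⊢
    split_ifs at hz ⊢
    · obtain ⟨t, _, ht⟩ := Finset.prod_eq_zero_iff.1 hz
      exact Finset.prod_eq_zero (Finset.mem_univ t) (hAB _ _ ht)
    · rfl
  · have hpt : ∀ z : Fin (M + 1) → Fin r, pathWeight B s z ^ 2 / pathWeight A s z =
        pathWeight (fun i j => B i j ^ 2 / A i j) s z := by
      intro z
      unfold pathWeight
      split_ifs
      · rw [← Finset.prod_pow, ← Finset.prod_div_distrib]
      · simp
    simp only [hpt]
    refine sub_le_sub_right (sum_pathWeight_le (fun i j => div_nonneg (sq_nonneg _) (hA0 i j))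
      (fun i => ?_) s M) 1
    -- The terms of first order, `2 * B - A`, sum to exactly one over a row.
    have hrow : ∀ j, B i j ^ 2 / A i j ≤ 2 * B i j - A i j + (A i j)⁻¹ * D ^ 2 := by
      intro j
      rcases eq_or_ne (A i j) 0 with h | h
      · simp [h, hAB i j h]
      · have hpos : 0 < A i j := lt_of_le_of_ne (hA0 i j) h.symm
        have e : B i j ^ 2 / A i j = 2 * B i j - A i j + (A i j)⁻¹ * (A i j - B i j) ^ 2 := by
          field_simp
          ring
        rw [e]
        have : (A i j - B i j) ^ 2 ≤ D ^ 2 := by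
          rw [← sq_abs]
          exact pow_le_pow_left₀ (abs_nonneg _) (hD i j) 2
        gcongr
    refine (Finset.sum_le_sum fun j _ => hrow j).trans ?_
    rw [Finset.sum_add_distrib, Finset.sum_sub_distrib, ← Finset.mul_sum, hA1, hB1,
      ← Finset.sum_mul]
    have : ∑ j, (A i j)⁻¹ ≤ ∑ i, ∑ j, (A i j)⁻¹ :=
      Finset.single_le_sum (f := fun i => ∑ j, (A i j)⁻¹)
        (fun i _ => Finset.sum_nonneg fun j _ => inv_nonneg.2 (hA0 i j)) (Finset.mem_univ i)
    have := mul_le_mul_of_nonneg_right this (sq_nonneg D)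
    linarith

theorem LocationPrivacy.IsMarkovChain.real_path_eq {Ω : Type*} [MeasurableSpace Ω] {Q : Measure Ω}
    {s : Fin r} {X : ℕ → Ω → Fin r} (hX : IsMarkovChain Q s A X) (hA : ∀ i j, 0 ≤ A i j) (M : ℕ)
    (z : Fin (M + 1) → Fin r) :
    Q.real ((fun ω (t : Fin (M + 1)) => X t ω) ⁻¹' {z}) = pathWeight A s z := by
  have h := hX M fun t => if ht : t < M + 1 then z ⟨t, ht⟩ else s
  have hset : {ω | ∀ t ≤ M, X t ω = if ht : t < M + 1 then z ⟨t, ht⟩ else s} =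
      (fun ω (t : Fin (M + 1)) => X t ω) ⁻¹' {z} := by
    ext ω
    simp only [Set.mem_ofPred_eq, Set.mem_preimage, Set.mem_singleton_iff, funext_iff]
    constructor
    · intro h t
      rw [h t (Nat.lt_succ_iff.1 t.2), dif_pos t.2]
    · intro h t ht
      rw [dif_pos (Nat.lt_succ_iff.2 ht), ← h]
  have hw : (if (if ht : 0 < M + 1 then z ⟨0, ht⟩ else s) = s then ∏ t ∈ Finset.range M,
      A (if ht : t < M + 1 then z ⟨t, ht⟩ else s)
        (if ht : t + 1 < M + 1 then z ⟨t + 1, ht⟩ else s) else 0) = pathWeight A s z := by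
    unfold pathWeight
    simp only [Nat.succ_pos, dite_true]
    refine if_congr Iff.rfl ?_ rfl
    rw [Finset.prod_range]
    refine Finset.prod_congr rfl fun t _ => ?_
    rw [dif_pos (by omega), dif_pos (by omega)]
    rfl
  rw [hset] at h
  rw [measureReal_def, h, ← hw, ENNReal.toReal_ofReal]
  rw [hw]
  exact pathWeight_nonneg hA s z

end PathWeight

/-! ### Dependence of the transition matrix on the free parameters -/

section TransitionMatrix

variable {r : ℕ} {E Ed : Finset (Fin r × Fin r)}

theorem card_add_of_isFreeEdgeSet (hfree : IsFreeEdgeSet E Ed) : Ed.card + r = E.card := by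
  have h : (E \ Ed).card = r := by
    obtain ⟨_, h2⟩ := hfree
    choose φ hφ hu using h2
    have := Finset.card_nbij' (s := E \ Ed) (t := (Finset.univ : Finset (Fin r))) Prod.fst
      (fun i => (i, φ i)) (fun _ _ => Finset.mem_univ _) (fun i _ => Finset.mem_sdiff.2 (hφ i))
      (fun p hp => Prod.ext rfl (hu p.1 p.2 (Finset.mem_sdiff.1 hp)).symm) (fun i _ => rfl)
    simpa using this
  rw [← Finset.card_sdiff_add_card_eq_card hfree.1, h, add_comm]

theorem sum_row_eq (θ : Ed → ℝ) (i : Fin r) :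
    ∑ e : Ed, (if e.1.1 = i then θ e else 0) =
      ∑ j, if h : (i, j) ∈ Ed then θ ⟨(i, j), h⟩ else 0 := by
  set g : Fin r × Fin r → ℝ := fun p => if h : p ∈ Ed then θ ⟨p, h⟩ else 0
  have h1 : ∀ e : Ed, (if e.1.1 = i then θ e else 0) =
      (fun p => if p.1 = i then g p else 0) e.1 := fun e => by simp [g]
  rw [Finset.sum_congr rfl fun e _ => h1 e,
    Finset.sum_coe_sort Ed fun p => if p.1 = i then g p else 0,
    Finset.sum_subset (Finset.subset_univ Ed) fun p _ hp => by simp [g, hp],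
    Fintype.sum_prod_type, Finset.sum_eq_single i]
  · simp [g]
  · intro b _ hb
    simp [hb]
  · simp

theorem sum_transitionMatrix (hfree : IsFreeEdgeSet E Ed) (θ : Ed → ℝ) (i : Fin r) :
    ∑ j, transitionMatrix E Ed θ i j = 1 := by
  obtain ⟨j₀, hj₀, huniq⟩ := hfree.2 i
  have h : ∀ j, transitionMatrix E Ed θ i j = (if h : (i, j) ∈ Ed then θ ⟨(i, j), h⟩ else 0) +
      if j = j₀ then 1 - ∑ e : Ed, (if e.1.1 = i then θ e else 0) else 0 := by
    intro j
    rcases eq_or_ne j j₀ with rfl | hj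
    · simp [transitionMatrix, hj₀.1, hj₀.2]
    · by_cases hd : (i, j) ∈ Ed
      · simp [transitionMatrix, hd, hj]
      · have : (i, j) ∉ E := fun hE => hj (huniq j ⟨hE, hd⟩)
        simp [transitionMatrix, hd, hj, this]
  simp only [h, Finset.sum_add_distrib, Finset.sum_ite_eq', Finset.mem_univ, if_true]
  rw [sum_row_eq]
  ring

theorem transitionMatrix_of_notMem (hfree : IsFreeEdgeSet E Ed) (θ : Ed → ℝ) {i j : Fin r}
    (h : (i, j) ∉ E) : transitionMatrix E Ed θ i j = 0 := by
  have hd : (i, j) ∉ Ed := fun hd => h (hfree.1 hd)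
  simp [transitionMatrix, h, hd]

theorem transitionMatrix_nonneg (hfree : IsFreeEdgeSet E Ed) {θ : Ed → ℝ}
    (hθ : θ ∈ paramRegion E Ed) (i j : Fin r) : 0 ≤ transitionMatrix E Ed θ i j := by
  by_cases h : (i, j) ∈ E
  · exact (hθ i j h).le
  · exact (transitionMatrix_of_notMem hfree θ h).ge

theorem transitionMatrix_eq_zero_iff (hfree : IsFreeEdgeSet E Ed) {θ : Ed → ℝ}
    (hθ : θ ∈ paramRegion E Ed) (i j : Fin r) :
    transitionMatrix E Ed θ i j = 0 ↔ (i, j) ∉ E :=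
  ⟨fun h hE => (hθ i j hE).ne' h, transitionMatrix_of_notMem hfree θ⟩

/-- In the sup metric a free entry moves by at most the distance, and a determined entry by at most
`Ed.card` times it. -/
theorem abs_transitionMatrix_sub_le (θ θ' : Ed → ℝ) (i j : Fin r) :
    |transitionMatrix E Ed θ i j - transitionMatrix E Ed θ' i j| ≤
      (Ed.card + 1) * dist θ θ' := by
  have hd0 : 0 ≤ dist θ θ' := dist_nonneg
  have hc0 : (0 : ℝ) ≤ Ed.card := Nat.cast_nonneg _
  have hle : ∀ e, |θ e - θ' e| ≤ dist θ θ' := fun e => by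
    rw [← Real.dist_eq]
    exact dist_le_pi_dist θ θ' e
  simp only [transitionMatrix, Matrix.of_apply]
  split_ifs
  · nlinarith [hle ⟨(i, j), ‹_›⟩]
  · rw [sub_sub_sub_cancel_left, ← Finset.sum_sub_distrib]
    calc _ ≤ ∑ _e : Ed, dist θ θ' := by
          refine (Finset.abs_sum_le_sum_abs _ _).trans (Finset.sum_le_sum fun e _ => ?_)
          split_ifs
          · rw [abs_sub_comm]
            exact hle e
          · simp [hd0]
      _ ≤ _ := by
          simp
          linarith
  · simp
    positivity

theorem isOpen_paramRegion : IsOpen (paramRegion E Ed) := by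
  have hc : ∀ i j, Continuous fun θ : Ed → ℝ => transitionMatrix E Ed θ i j := by
    intro i j
    simp only [transitionMatrix, Matrix.of_apply]
    split_ifs
    · fun_prop
    · refine continuous_const.sub (continuous_finsetSum _ fun e _ => ?_)
      split_ifs <;> fun_prop
    · fun_prop
  simp only [paramRegion, Set.ofPred_forall]
  exact isOpen_iInter_of_finite fun i => isOpen_iInter_of_finite fun j =>
    isOpen_iInter_of_finite fun _ => isOpen_lt continuous_const (hc i j)

/-- Chains with close parameters have paths with close laws. -/
theorem exists_sum_abs_pathWeight_sub_le (hfree : IsFreeEdgeSet E Ed) {θ : Ed → ℝ}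
    (hθ : θ ∈ paramRegion E Ed) (s : Fin r) :
    ∃ C, 0 ≤ C ∧ ∀ θ' ∈ paramRegion E Ed, ∀ ε, dist θ θ' ≤ ε → ∀ M : ℕ,
      ∑ z : Fin (M + 1) → Fin r, |pathWeight (transitionMatrix E Ed θ) s z -
        pathWeight (transitionMatrix E Ed θ') s z| ≤ √(Real.exp (C * (M * ε ^ 2)) - 1) := by
  set T := ∑ i, ∑ j, (transitionMatrix E Ed θ i j)⁻¹
  have hT : 0 ≤ T := Finset.sum_nonneg fun i _ => Finset.sum_nonneg fun j _ =>
    inv_nonneg.2 (transitionMatrix_nonneg hfree hθ i j)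
  refine ⟨T * (Ed.card + 1) ^ 2, by positivity, fun θ' hθ' ε hε M => ?_⟩
  refine (sum_abs_pathWeight_sub_le (D := (Ed.card + 1) * ε)
    (transitionMatrix_nonneg hfree hθ) (fun i j h => ?_) (sum_transitionMatrix hfree θ)
    (sum_transitionMatrix hfree θ') (fun i j => ?_) s M).trans ?_
  · rw [transitionMatrix_eq_zero_iff hfree hθ']
    rwa [transitionMatrix_eq_zero_iff hfree hθ] at h
  · exact (abs_transitionMatrix_sub_le θ θ' i j).trans
      (mul_le_mul_of_nonneg_left hε (by positivity))
  · refine Real.sqrt_le_sqrt (sub_le_sub_right ?_ 1)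
    calc _ ≤ Real.exp (T * ((Ed.card + 1) * ε) ^ 2) ^ M := by
          refine pow_le_pow_left₀ (by positivity) ?_ M
          rw [add_comm]
          exact Real.add_one_le_exp _
      _ = _ := by
          rw [← Real.exp_nat_mul]
          ring_nf

end TransitionMatrix

/-! ### Many users have parameters close to those of user 1 -/

theorem summable_exp_neg_mul_rpow {b γ : ℝ} (hb : 0 < b) (hγ : 0 < γ) :
    Summable fun n : ℕ => Real.exp (-b * (n : ℝ) ^ γ) := by
  have h1 : Tendsto (fun n : ℕ => (n : ℝ) ^ γ) atTop atTop :=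
    (tendsto_rpow_atTop hγ).comp tendsto_natCast_atTop_atTop
  have h2 := ((isLittleO_exp_neg_mul_rpow_atTop hb (-(2 / γ))).comp_tendsto h1).isBigO
  refine summable_of_isBigO_nat (g := fun n : ℕ => (n : ℝ) ^ (-2 : ℝ))
    (Real.summable_nat_rpow.2 (by norm_num)) (h2.trans_eventuallyEq (Eventually.of_forall ?_))
  intro n
  simp only [Function.comp_apply]
  rw [← Real.rpow_mul (Nat.cast_nonneg n)]
  congr 1
  field_simp

/-- The integral is `1 - μ(A) / 2`, and `1 - t ≤ exp (-t)`. -/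
theorem lintegral_ite_half_le {Ω : Type*} [MeasurableSpace Ω] {μ : Measure Ω}
    [IsProbabilityMeasure μ] {A : Set Ω} [DecidablePred (· ∈ A)] (hA : MeasurableSet A) {q : ℝ}
    (hq : q ≤ μ.real A) :
    ∫⁻ ω, (if ω ∈ A then 2⁻¹ else 1 : ℝ≥0∞) ∂μ ≤ ENNReal.ofReal (Real.exp (-(q / 2))) := by
  rw [← lintegral_add_compl _ hA,
    setLIntegral_congr_fun (g := fun _ => 2⁻¹) hA (fun ω hω => if_pos hω),
    setLIntegral_congr_fun (g := fun _ => 1) hA.compl (fun ω hω => if_neg hω),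
    setLIntegral_const, setLIntegral_const, one_mul, ← ofReal_measureReal (μ := μ) (s := A),
    ← ofReal_measureReal (μ := μ) (s := Aᶜ),
    show (2⁻¹ : ℝ≥0∞) = ENNReal.ofReal 2⁻¹ by
      rw [ENNReal.ofReal_inv_of_pos (by norm_num), ENNReal.ofReal_ofNat],
    ← ENNReal.ofReal_mul (by norm_num), ← ENNReal.ofReal_add (by positivity) (by positivity),
    probReal_compl_eq_one_sub hA]
  refine ENNReal.ofReal_le_ofReal ?_
  have := Real.add_one_le_exp (-(q / 2))
  linarith

theorem eventually_le_withDensity_closedBall {ι : Type*} [Fintype ι] {R : Set (ι → ℝ)}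
    (hR : IsOpen R) {f : (ι → ℝ) → ℝ} {δ : ℝ} (hf : ∀ θ ∈ R, δ ≤ f θ) {θ : ι → ℝ} (hθ : θ ∈ R)
    {ε : ℕ → ℝ} (hε0 : ∀ n, 0 ≤ ε n) (hε : Tendsto ε atTop (𝓝 0)) :
    ∀ᶠ n in atTop, ENNReal.ofReal (δ * ε n ^ Fintype.card ι) ≤
      volume.withDensity (fun θ => ENNReal.ofReal (f θ)) (Metric.closedBall θ (ε n)) := by
  obtain ⟨ρ, hρ, hball⟩ := Metric.isOpen_iff.1 hR θ hθ
  filter_upwards [hε.eventually_lt_const hρ] with n hn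
  have hsub : Metric.closedBall θ (ε n) ⊆ R := (Metric.closedBall_subset_ball hn).trans hball
  rw [withDensity_apply _ Metric.isClosed_closedBall.measurableSet]
  calc _ ≤ ENNReal.ofReal δ * volume (Metric.closedBall θ (ε n)) := by
        rw [Real.volume_pi_closedBall _ (hε0 n), ENNReal.ofReal_mul' (pow_nonneg (hε0 n) _)]
        gcongr
        · exact hε0 n
        · linarith [hε0 n]
    _ = ∫⁻ _ in Metric.closedBall θ (ε n), ENNReal.ofReal δ := (setLIntegral_const _ _).symm
    _ ≤ _ := setLIntegral_mono' Metric.isClosed_closedBall.measurableSet fun x hx =>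
        ENNReal.ofReal_le_ofReal (hf x (hsub hx))

open Classical in
/-- The number of users with parameters in a ball of radius `n ^ (-β)` around those of user `0`
almost surely tends to infinity. -/
theorem ae_tendsto_card_dist_le {Ω ι : Type*} [Fintype ι] [MeasurableSpace Ω] {μ : Measure Ω}
    [IsProbabilityMeasure μ] {R : Set (ι → ℝ)} (hR : IsOpen R) {f : (ι → ℝ) → ℝ} {δ : ℝ}
    (hδ : 0 < δ) (hf : ∀ θ ∈ R, δ ≤ f θ) {P : ℕ → Ω → ι → ℝ} (hP : ∀ u, Measurable (P u))
    (hPi : iIndepFun P μ) (hP0 : ∀ᵐ ω ∂μ, P 0 ω ∈ R)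
    (hPlaw : ∀ u, u ≠ 0 → μ.map (P u) = volume.withDensity fun θ => ENNReal.ofReal (f θ))
    {β : ℝ} (hβ : 0 < β) (hβ1 : β * Fintype.card ι < 1) :
    ∀ᵐ ω ∂μ, Tendsto (fun n : ℕ => ((Finset.range (n - 1)).filter fun u =>
      P (u + 1) ω ∈ Metric.closedBall (P 0 ω) ((n : ℝ) ^ (-β))).card) atTop atTop := by
  set ε : ℕ → ℝ := fun n => (n : ℝ) ^ (-β) with hεdef
  have hε0 : ∀ n, 0 ≤ ε n := fun n => Real.rpow_nonneg (Nat.cast_nonneg n) _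
  have hε : Tendsto ε atTop (𝓝 0) := (tendsto_rpow_neg_atTop hβ).comp tendsto_natCast_atTop_atTop
  -- `F n` is `2⁻¹` to the power of the number of users in the ball: a product of independent
  -- factors once the centre is fixed, and small exactly when the number is large.
  set F : ℕ → (ι → ℝ) × (ℕ → ι → ℝ) → ℝ≥0∞ := fun n p =>
    ∏ u ∈ Finset.range (n - 1), if p.2 u ∈ Metric.closedBall p.1 (ε n) then 2⁻¹ else 1 with hF
  have hFm : ∀ n, Measurable (F n) := by
    intro n
    refine Finset.measurable_prod _ fun u _ => Measurable.ite ?_ measurable_const measurable_const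
    simp only [Metric.mem_closedBall]
    exact measurableSet_le (((measurable_pi_apply u).comp measurable_snd).dist measurable_fst)
      measurable_const
  set V : Ω → ℕ → ι → ℝ := fun ω u => P (u + 1) ω with hV
  have hVm : Measurable V := measurable_pi_iff.2 fun u => hP (u + 1)
  have hind : IndepFun (P 0) V μ := by
    have h := indep_iSup_of_disjoint (fun u => (hP u).comap_le) hPi.iIndep
      (S := {0}) (T := {0}ᶜ) disjoint_compl_right
    refine indep_of_indep_of_le_left (indep_of_indep_of_le_right h ?_) ?_
    · refine measurable_iff_comap_le.1 (@measurable_pi_iff Ω ℕ (fun _ => ι → ℝ)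
        (⨆ i ∈ ({0}ᶜ : Set ℕ), _) _ V |>.2 fun u => measurable_iff_comap_le.2 ?_)
      exact le_iSup₂_of_le (u + 1) (by simp) le_rfl
    · exact le_iSup₂_of_le 0 rfl le_rfl
  -- With the centre fixed, summable expectations give an almost surely finite sum, as in
  -- Borel–Cantelli; Fubini then restores the random centre, which is independent of the other
  -- users.
  have hsection : ∀ θ ∈ R, ∀ᵐ v ∂(μ.map V), ∑' n, F n (θ, v) ≠ ∞ := by
    intro θ hθ
    have hFθ : ∀ n, Measurable fun v => F n (θ, v) := fun n =>
      (hFm n).comp measurable_prodMk_left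
    have hbound : ∀ᶠ n : ℕ in atTop, ∫⁻ v, F n (θ, v) ∂(μ.map V) ≤
        ENNReal.ofReal (Real.exp (-(δ / 4) * (n : ℝ) ^ (1 - β * Fintype.card ι))) := by
      filter_upwards [eventually_le_withDensity_closedBall hR hf hθ hε0 hε,
        eventually_ge_atTop 2] with n hn hn2
      set q := δ * ε n ^ Fintype.card ι with hq
      have hA : ∀ u, MeasurableSet (P (u + 1) ⁻¹' Metric.closedBall θ (ε n)) := fun u =>
        hP (u + 1) Metric.isClosed_closedBall.measurableSet
      have hqle : ∀ u, q ≤ μ.real (P (u + 1) ⁻¹' Metric.closedBall θ (ε n)) := by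
        intro u
        rw [← hPlaw (u + 1) u.succ_ne_zero,
          Measure.map_apply (hP _) Metric.isClosed_closedBall.measurableSet] at hn
        exact (ENNReal.ofReal_le_iff_le_toReal (measure_ne_top _ _)).1 hn
      rw [lintegral_map (hFθ n) hVm]
      have hsucc : Function.Injective fun u : ℕ => u + 1 := add_left_injective 1
      have hprod := lintegral_prod_eq_prod_lintegral_of_indepFun (μ := μ) (Finset.range (n - 1))
        (fun u ω => if P (u + 1) ω ∈ Metric.closedBall θ (ε n) then 2⁻¹ else 1)
        ((hPi.precomp hsucc).comp
          (fun _ x => if x ∈ Metric.closedBall θ (ε n) then (2⁻¹ : ℝ≥0∞) else 1)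
          (fun _ => Measurable.ite Metric.isClosed_closedBall.measurableSet
            measurable_const measurable_const))
        (fun u => Measurable.ite (hA u) measurable_const measurable_const)
      simp only [hF, hV]
      rw [hprod]
      calc _ ≤ ∏ _u ∈ Finset.range (n - 1), ENNReal.ofReal (Real.exp (-(q / 2))) :=
            Finset.prod_le_prod' fun u _ => lintegral_ite_half_le (hA u) (hqle u)
        _ ≤ _ := by
          rw [Finset.prod_const, Finset.card_range, ← ENNReal.ofReal_pow (Real.exp_pos _).le,
            ← Real.exp_nat_mul]
          refine ENNReal.ofReal_le_ofReal (Real.exp_le_exp.2 ?_)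
          have hn0 : (0 : ℝ) < n := by positivity
          have e1 : (n : ℝ) ^ (1 - β * Fintype.card ι) = n * ε n ^ Fintype.card ι := by
            rw [sub_eq_add_neg, Real.rpow_add hn0, Real.rpow_one, hεdef,
              ← neg_mul, Real.rpow_mul hn0.le, Real.rpow_natCast]
          have hn2' : (2 : ℝ) ≤ n := by exact_mod_cast hn2
          have hεn : 0 ≤ ε n ^ Fintype.card ι := pow_nonneg (hε0 n) _
          rw [e1, hq, Nat.cast_sub (by omega), Nat.cast_one]
          -- The constant `δ / 4` comes from `n - 1 ≥ n / 2`.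
          nlinarith [mul_nonneg (mul_nonneg hδ.le hεn) (sub_nonneg.2 hn2')]
    have hle1 : ∀ n, ∫⁻ v, F n (θ, v) ∂(μ.map V) ≤ 1 := by
      intro n
      have : IsProbabilityMeasure (μ.map V) := Measure.isProbabilityMeasure_map hVm.aemeasurable
      calc _ ≤ ∫⁻ _, 1 ∂(μ.map V) := lintegral_mono fun v => Finset.prod_le_one' fun u _ => by
            split_ifs
            · exact ENNReal.inv_le_one.2 one_le_two
            · exact le_rfl
        _ = 1 := by simp
    have hsum : ∑' n, ∫⁻ v, F n (θ, v) ∂(μ.map V) ≠ ∞ := by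
      have hne : ∀ n, ∫⁻ v, F n (θ, v) ∂(μ.map V) ≠ ∞ := fun n =>
        ((hle1 n).trans_lt ENNReal.one_lt_top).ne
      have hs : Summable fun n => (∫⁻ v, F n (θ, v) ∂(μ.map V)).toReal := by
        refine Summable.of_norm_bounded_eventually_nat
          (summable_exp_neg_mul_rpow (b := δ / 4) (by positivity) (sub_pos.2 hβ1)) ?_
        filter_upwards [hbound] with n hn
        rw [Real.norm_of_nonneg ENNReal.toReal_nonneg]
        exact ENNReal.toReal_le_of_le_ofReal (Real.exp_pos _).le hn
      have := hs.tsum_ofReal_ne_top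
      simpa only [ENNReal.ofReal_toReal (hne _)] using this
    rw [← lintegral_tsum fun n => (hFθ n).aemeasurable] at hsum
    filter_upwards [ae_lt_top (Measurable.tsum hFθ) hsum] with v hv using hv.ne
  have hae : ∀ᵐ ω ∂μ, ∑' n, F n (P 0 ω, V ω) ≠ ∞ := by
    have : IsProbabilityMeasure (μ.map V) := Measure.isProbabilityMeasure_map hVm.aemeasurable
    have : IsProbabilityMeasure (μ.map (P 0)) :=
      Measure.isProbabilityMeasure_map (hP 0).aemeasurable
    have hSm : MeasurableSet {p | ∑' n, F n p ≠ ∞} :=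
      (measurableSet_singleton ∞).compl.preimage (Measurable.tsum hFm)
    have h1 : ∀ᵐ p ∂(μ.map (P 0)).prod (μ.map V), ∑' n, F n p ≠ ∞ := by
      have hR0 : ∀ᵐ θ ∂μ.map (P 0), θ ∈ R := (ae_map_iff (hP 0).aemeasurable hR.measurableSet).2 hP0
      rw [Measure.ae_prod_iff_ae_ae hSm]
      filter_upwards [hR0] with θ hθ using hsection θ hθ
    rw [← (indepFun_iff_map_prod_eq_prod_map_map (hP 0).aemeasurable hVm.aemeasurable).1 hind]
      at h1
    exact ae_of_ae_map ((hP 0).prodMk hVm).aemeasurable h1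
  filter_upwards [hae] with ω hω
  have h0 := ENNReal.tendsto_atTop_zero_of_tsum_ne_top hω
  refine tendsto_atTop.2 fun K => ?_
  have hK : (0 : ℝ≥0∞) < 2⁻¹ ^ K := by
    rw [pos_iff_ne_zero]
    exact pow_ne_zero _ (ENNReal.inv_ne_zero.2 ENNReal.ofNat_ne_top)
  filter_upwards [h0.eventually_lt_const hK] with n hn
  simp only [hF, hV] at hn
  rw [Finset.prod_ite, Finset.prod_const_one, mul_one, Finset.prod_const] at hn
  by_contra hlt
  exact absurd (pow_le_pow_right_of_le_one' (ENNReal.inv_le_one.2 one_le_two)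
    (not_le.1 hlt).le) (not_le.2 hn)

/-! ### From close path laws to vanishing mutual information -/

/-- Duality: taking for `g` the sign of the deviation turns the `ℓ¹` distance into a covariance, the
form bounded by `abs_integral_mul_sub_le`. -/
theorem exists_sum_abs_eq_integral {Ω S T : Type*} [MeasurableSpace Ω] [DecidableEq S] [Fintype T]
    [MeasurableSpace S] [MeasurableSingletonClass S] [MeasurableSpace T]
    [MeasurableSingletonClass T] (Q : Measure Ω) [IsProbabilityMeasure Q]
    {U : Ω → S} {V : Ω → T} (hU : Measurable U) (hV : Measurable V) (x : S) :
    ∃ g : T → ℝ, (∀ y, |g y| ≤ 1) ∧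
      ∑ y, |Q.real (U ⁻¹' {x} ∩ V ⁻¹' {y}) - Q.real (U ⁻¹' {x}) * Q.real (V ⁻¹' {y})| =
        ∫ ω, ((if U ω = x then 1 else 0) - ∫ ω, (if U ω = x then 1 else 0) ∂Q) * g (V ω) ∂Q := by
  classical
  have hUx : MeasurableSet (U ⁻¹' {x}) := hU (measurableSet_singleton x)
  have hVy : ∀ y, MeasurableSet (V ⁻¹' {y}) := fun y => hV (measurableSet_singleton y)
  have hp : ∫ ω, (if U ω = x then 1 else 0) ∂Q = Q.real (U ⁻¹' {x}) := by
    rw [← integral_indicator_one hUx]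
    congr 1 with ω
    simp [Set.indicator_apply]
  set D : T → ℝ := fun y =>
    Q.real (U ⁻¹' {x} ∩ V ⁻¹' {y}) - Q.real (U ⁻¹' {x}) * Q.real (V ⁻¹' {y}) with hD
  refine ⟨fun y => SignType.sign (D y), fun y => ?_, ?_⟩
  · rcases lt_trichotomy (D y) 0 with h | h | h <;> simp [h]
  rw [hp]
  have hpt : ∀ ω, ((if U ω = x then 1 else 0) - Q.real (U ⁻¹' {x})) *
      ((SignType.sign (D (V ω)) : SignType) : ℝ) =
      ∑ y, (SignType.sign (D y) : ℝ) * ((U ⁻¹' {x} ∩ V ⁻¹' {y}).indicator 1 ω -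
        Q.real (U ⁻¹' {x}) * (V ⁻¹' {y}).indicator 1 ω) := by
    intro ω
    rw [Finset.sum_eq_single (V ω)]
    · by_cases h : U ω = x <;> simp [h, mul_comm]
    · intro y _ hy
      simp [hy.symm]
    · simp
  have hint : ∀ A : Set Ω, MeasurableSet A → Integrable (A.indicator (1 : Ω → ℝ)) Q := fun A hA =>
    (integrable_const 1).indicator hA
  simp only [hpt]
  rw [integral_finsetSum]
  · refine Finset.sum_congr rfl fun y _ => ?_
    rw [integral_const_mul, integral_sub (hint _ (hUx.inter (hVy y))) ((hint _ (hVy y)).const_mul _),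
      integral_const_mul, integral_indicator_one (hUx.inter (hVy y)), integral_indicator_one (hVy y)]
    exact (sign_mul_self (D y)).symm
  · intro y _
    exact ((hint _ (hUx.inter (hVy y))).sub ((hint _ (hVy y)).const_mul _)).const_mul _

/-- The information leaked about user `0` when the users in `J` move almost like user `0`. -/
theorem mutualInfo_observation_le {Ω : Type*} [MeasurableSpace Ω] {Q : Measure Ω}
    [IsProbabilityMeasure Q] {r : ℕ} {s : Fin r} {A : ℕ → Matrix (Fin r) (Fin r) ℝ}
    {X : ℕ → ℕ → Ω → Fin r} {Pm : (n : ℕ) → Ω → Equiv.Perm (Fin n)}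
    (hmodel : IsAnonymizedModel Q s A X Pm) (hA : ∀ u i j, 0 ≤ A u i j) {n : ℕ} (hn : 0 < n)
    {m k M : ℕ} (hm : m ≤ M + 1) (hk : k < M + 1) {J : Finset (Fin n)} (hJ : J.Nonempty) {η : ℝ}
    (hη : ∀ j ∈ J, ∑ z : Fin (M + 1) → Fin r, |pathWeight (A 0) s z - pathWeight (A j) s z| ≤ η) :
    mutualInfo Q (X 0 k) (observation X (Pm n) m) ≤
      ENNReal.ofReal ((∑ x, (Q.real (X 0 k ⁻¹' {x}))⁻¹) * (3 * η + 1 / √J.card)) := by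
  have : MeasurableSingletonClass (Equiv.Perm (Fin n)) := ⟨fun _ => trivial⟩
  set Z : Fin n → Ω → Fin (M + 1) → Fin r := fun u ω t => X u t ω with hZdef
  have hZ : ∀ i, Measurable (Z i) := fun i =>
    measurable_pi_iff.2 fun t => hmodel.measurable_loc i t
  have hZi : iIndepFun Z Q :=
    (hmodel.indep_users.precomp Fin.val_injective).comp (fun _ x (t : Fin (M + 1)) => x t)
      fun _ => measurable_pi_iff.2 fun t => measurable_pi_apply _
  have hrestr : Measurable fun (x : ℕ → ℕ → Fin r) (i : Fin n) (t : Fin (M + 1)) => x i t := by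
    fun_prop
  have hind : IndepFun (Pm n) (fun ω i => Z i ω) Q :=
    (hmodel.indep_perm n).comp measurable_id hrestr
  -- The paths `Z` run up to time `M`, covering both the observed times and time `k`, which may lie
  -- beyond them; the adversary sees a truncation of the permuted paths.
  set restr : (Fin n → Fin (M + 1) → Fin r) → Fin n → Fin m → Fin r :=
    fun y v t => y v (Fin.castLE hm t)
  have hobs : ∀ ω, observation X (Pm n) m ω = restr fun v => Z ((Pm n ω).symm v) ω :=
    fun ω => rfl
  have hYm : Measurable (observation X (Pm n) m) := by
    have h := (Measurable.of_discrete (f := fun p : Equiv.Perm (Fin n) ×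
      (Fin n → Fin (M + 1) → Fin r) => restr fun v => p.2 (p.1.symm v))).comp
      ((hmodel.measurable_perm n).prodMk (measurable_pi_iff.2 hZ))
    exact h
  refine (mutualInfo_le_sum Q (hmodel.measurable_loc 0 k) hYm).trans
    (ENNReal.ofReal_le_ofReal ?_)
  rw [Finset.sum_mul]
  refine Finset.sum_le_sum fun x _ => mul_le_mul_of_nonneg_left ?_ (by positivity)
  obtain ⟨g, hg, hsum⟩ := exists_sum_abs_eq_integral Q (hmodel.measurable_loc 0 k) hYm x
  rw [hsum]
  refine (le_abs_self _).trans ?_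
  have hlaw : ∀ (j : Fin n) (z), Q.real (Z j ⁻¹' {z}) = pathWeight (A j) s z := fun j z =>
    (hmodel.chain j).real_path_eq (hA j) M z
  refine abs_integral_mul_sub_le hZ hZi (hmodel.measurable_perm n) (hmodel.uniform_perm n) hind
    (h := fun z => if z ⟨k, hk⟩ = x then 1 else 0) (fun z => by positivity)
    (fun z => by split_ifs <;> norm_num) (g := fun y => g (restr y)) (fun y => hg _) ⟨0, hn⟩ J hJ
    fun j hj => ?_
  simp only [hlaw]
  exact hη j hj

/-- The power `n ^ (a - 2β)` tends to zero; the rounding error and `k` contribute only `(1 + k) * n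
^ (-2β)`. The exponent `a` may be negative. -/
theorem tendsto_mul_rpow_neg_sq {m : ℕ → ℕ} {c a β : ℝ}
    (hm : ∀ n : ℕ, |(m n : ℝ) - c * (n : ℝ) ^ a| < 1) (hβ : 0 < β) (haβ : a < 2 * β) (k : ℕ) :
    Tendsto (fun n : ℕ => ((m n + k : ℕ) : ℝ) * ((n : ℝ) ^ (-β)) ^ 2) atTop (𝓝 0) := by
  have h1 : Tendsto (fun n : ℕ => c * (n : ℝ) ^ (-(2 * β - a)) +
      (1 + k) * (n : ℝ) ^ (-(2 * β))) atTop (𝓝 (c * 0 + (1 + k) * 0)) :=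
    (((tendsto_rpow_neg_atTop (sub_pos.2 haβ)).comp tendsto_natCast_atTop_atTop).const_mul c).add
      (((tendsto_rpow_neg_atTop (by linarith : 0 < 2 * β)).comp
        tendsto_natCast_atTop_atTop).const_mul _)
  rw [mul_zero, mul_zero, add_zero] at h1
  refine tendsto_of_tendsto_of_tendsto_of_le_of_le' tendsto_const_nhds h1
    (Eventually.of_forall fun n => by positivity) ?_
  filter_upwards [eventually_gt_atTop 0] with n hn
  have hn0 : (0 : ℝ) < n := by exact_mod_cast hn
  have e1 : ((n : ℝ) ^ (-β)) ^ 2 = (n : ℝ) ^ (-(2 * β)) := by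
    rw [← Real.rpow_natCast, ← Real.rpow_mul hn0.le]
    congr 1
    push_cast
    ring
  have e2 : (n : ℝ) ^ (-(2 * β - a)) = (n : ℝ) ^ a * (n : ℝ) ^ (-(2 * β)) := by
    rw [← Real.rpow_add hn0]
    congr 1
    ring
  rw [e1, e2, ← mul_assoc, ← add_mul]
  refine mul_le_mul_of_nonneg_right ?_ (Real.rpow_nonneg hn0.le _)
  push_cast
  linarith [(abs_lt.1 (hm n)).2]

theorem theorem3 {r : ℕ} (E Ed : Finset (Fin r × Fin r)) (s : Fin r)
    (hirr : (adjacency E).IsIrreducible) (haper : IsAperiodic (adjacency E))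
    (hfree : IsFreeEdgeSet E Ed) (hd : r < E.card)
    (f : (Ed → ℝ) → ℝ) (hf : Measurable f) (δ₁ δ₂ : ℝ) (hδ₁ : 0 < δ₁)
    (hfR : ∀ θ ∈ paramRegion E Ed, δ₁ < f θ ∧ f θ < δ₂)
    (hf0 : ∀ θ, θ ∉ paramRegion E Ed → f θ = 0)
    {Ω : Type*} [MeasurableSpace Ω] (μ : Measure Ω) [IsProbabilityMeasure μ]
    (P : ℕ → Ω → (Ed → ℝ)) (hPmeas : ∀ u, Measurable (P u)) (hPindep : iIndepFun P μ)
    (hP0 : ∀ᵐ ω ∂μ, P 0 ω ∈ paramRegion E Ed)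
    (hPlaw : ∀ u, u ≠ 0 → μ.map (P u) = volume.withDensity fun θ => ENNReal.ofReal (f θ))
    (c α : ℝ) (hc : 0 < c) (hα : 0 < α) (m : ℕ → ℕ)
    (hm : ∀ n : ℕ, |(m n : ℝ) - c * (n : ℝ) ^ (2 / ((E.card : ℝ) - (r : ℝ)) - α)| < 1) :
    ∀ᵐ ω ∂μ, ∀ (Ω' : Type*) [MeasurableSpace Ω'] (Q : Measure Ω') [IsProbabilityMeasure Q]
      (X : ℕ → ℕ → Ω' → Fin r) (Pm : (n : ℕ) → Ω' → Equiv.Perm (Fin n)),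
      IsAnonymizedModel Q s (fun u => transitionMatrix E Ed (P u ω)) X Pm →
        ∀ k : ℕ, PerfectLocationPrivacy Q X Pm m 0 k := by
  classical
  set R := paramRegion E Ed with hR
  have hcard := card_add_of_isFreeEdgeSet hfree
  have hd' : (E.card : ℝ) - r = Ed.card := by
    rw [← hcard]
    push_cast
    ring
  have hdpos : (0 : ℝ) < Ed.card := by
    rw [← hd', sub_pos]
    exact_mod_cast hd
  rw [hd'] at hm
  have hdinv : (0 : ℝ) < 1 / Ed.card := by positivity
  -- The choice `β = 1 / d - x / 4` meets three demands: `x ≤ 1 / d` keeps `β` positive, `x > 0`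
  -- gives `β * d < 1` (many neighbours), and `x ≤ α` gives `2 / d - α < 2 * β` (close path laws).
  obtain ⟨x, hx0, hxα, hxd⟩ : ∃ x : ℝ, 0 < x ∧ x ≤ α ∧ x ≤ 1 / Ed.card :=
    ⟨min α (1 / Ed.card), lt_min hα hdinv, min_le_left _ _, min_le_right _ _⟩
  set β : ℝ := 1 / Ed.card - x / 4 with hβdef
  have hβ : 0 < β := by linarith
  have hβ1 : β * Fintype.card Ed < 1 := by
    rw [Fintype.card_coe, ← lt_div_iff₀ hdpos]
    linarith
  have haβ : 2 / (Ed.card : ℝ) - α < 2 * β := by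
    have : 2 / (Ed.card : ℝ) = 2 * (1 / Ed.card) := by ring
    linarith
  have hmem : ∀ u, ∀ᵐ ω ∂μ, P u ω ∈ R := by
    intro u
    rcases eq_or_ne u 0 with rfl | hu
    · exact hP0
    · refine ae_of_ae_map (hPmeas u).aemeasurable (p := fun θ => θ ∈ R) ?_
      rw [hPlaw u hu, ae_withDensity_iff hf.ennreal_ofReal]
      refine ae_of_all _ fun θ hθ => ?_
      by_contra hne
      exact hθ (by rw [hf0 θ hne, ENNReal.ofReal_zero])
  filter_upwards [ae_all_iff.2 hmem, ae_tendsto_card_dist_le isOpen_paramRegion hδ₁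
    (fun θ hθ => (hfR θ hθ).1.le) hPmeas hPindep hP0 hPlaw hβ hβ1] with ω hω hN
  intro Ω' _ Q _ X Pm hmodel k
  obtain ⟨C, hC0, hC⟩ := exists_sum_abs_pathWeight_sub_le hfree (hω 0) s
  set N : ℕ → ℕ := fun n => ((Finset.range (n - 1)).filter fun u =>
      P (u + 1) ω ∈ Metric.closedBall (P 0 ω) ((n : ℝ) ^ (-β))).card with hNdef
  set η : ℕ → ℝ := fun n => √(Real.exp (C * (((m n + k : ℕ) : ℝ) * ((n : ℝ) ^ (-β)) ^ 2)) - 1)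
    with hηdef
  have hη : Tendsto η atTop (𝓝 0) := by
    have h := (tendsto_mul_rpow_neg_sq hm hβ haβ k).const_mul C
    rw [mul_zero] at h
    have h2 := (((Real.continuous_exp.tendsto 0).comp h).sub_const 1).sqrt
    rwa [Real.exp_zero, sub_self, Real.sqrt_zero] at h2
  have hNsqrt : Tendsto (fun n => 1 / √(N n : ℝ)) atTop (𝓝 0) := by
    simp only [one_div]
    exact (Real.tendsto_sqrt_atTop.comp
      (tendsto_natCast_atTop_atTop.comp hN)).inv_tendsto_atTop
  have hbound : Tendsto (fun n => ENNReal.ofReal ((∑ x, (Q.real (X 0 k ⁻¹' {x}))⁻¹) *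
      (3 * η n + 1 / √(N n : ℝ)))) atTop (𝓝 0) := by
    have h := ((hη.const_mul 3).add hNsqrt).const_mul (∑ x, (Q.real (X 0 k ⁻¹' {x}))⁻¹)
    rw [mul_zero, add_zero, mul_zero] at h
    simpa using ENNReal.tendsto_ofReal h
  refine tendsto_of_tendsto_of_tendsto_of_le_of_le' tendsto_const_nhds hbound
    (Eventually.of_forall fun n => zero_le) ?_
  filter_upwards [hN.eventually_gt_atTop 0, eventually_gt_atTop 0] with n hNpos hn
  set J : Finset (Fin n) := Finset.univ.filter fun u =>
    P u ω ∈ Metric.closedBall (P 0 ω) ((n : ℝ) ^ (-β)) with hJ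
  -- `N n` counts the neighbours with indices `1, …, n - 1`, shifted down by one; `J` also contains
  -- user `0`, so only an inequality holds.
  have hNJ : N n ≤ J.card := by
    rw [← Finset.card_map (s := J) Fin.valEmbedding]
    refine Finset.card_le_card_of_injOn (fun u => u + 1) (fun u hu => ?_)
      (add_left_injective 1).injOn
    obtain ⟨hv, hvd⟩ := Finset.mem_filter.1 hu
    rw [Finset.mem_range] at hv
    exact Finset.mem_map.2 ⟨⟨u + 1, by omega⟩, Finset.mem_filter.2 ⟨Finset.mem_univ _, hvd⟩, rfl⟩
  have hNpos' : 0 < N n := hNpos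
  refine (mutualInfo_observation_le hmodel (fun u => transitionMatrix_nonneg hfree (hω u)) hn
    (M := m n + k) (by omega) (by omega) (J := J) (Finset.card_pos.1 (by omega))
    (η := η n) fun j hj => ?_).trans (ENNReal.ofReal_le_ofReal ?_)
  · refine hC _ (hω j) _ ?_ _
    rw [dist_comm]
    exact (Finset.mem_filter.1 hj).2
  · refine mul_le_mul_of_nonneg_left ?_
      (Finset.sum_nonneg fun x _ => inv_nonneg.2 measureReal_nonneg)
    gcongr
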